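/- Let $n\ge 1$ and let $W(A_n)$ be the Coxeter group of type $A_n$ with generators $\sigma_1,\dots,\sigma_n$ ($\sigma_a,\sigma_b$ commute iff $|a-b|\ne 1$, and $m_{ab}=3$ if $|a-b|=1$). An element $w$ is fully commutative (FC) if any reduced expression of $w$ can be obtained from any other by commutation relations only. For $1\le i\le j\le n$ put $[i,j]=\sigma_i\sigma_{i+1}\cdots\sigma_j$. Every FC element has a unique canonical form $$w=[i_1,j_1][i_2,j_2]\cdots[i_p,j_p],\qquad n\ge i_1>\dots>i_p\ge 1,\quad n\ge j_1>\dots>j_p\ge 1,\quad i_t\le j_t\ (1\le t\le p),$$ and $p$ is called the size of $w$ (the identity has size $0$). The element $w\neq 1$ has first block $[i_1,j_1]$ and last block $[i_p,j_p]$; it starts with $\sigma_{i_1}$ and ends with $\sigma_{j_p}$. Then: 1. For $1\le i\le j\le n$, the number of FC elements of $W(A_n)$ with first block $[i,j]$ is $$\frac{j-i+2}{j+1}\binom{j+i-1}{j},$$ and the number of those with last block $[i,j]$ is $$\frac{j-i+2}{n-i+2}\binom{2n-j-i+1}{n-j}.$$ 2. For $1\le i,j\le n$ and $1\le p\le n$,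 the number of FC elements of size $p$ starting with $\sigma_i$ is $$\frac{n+1-i}{n+1-p}\binom{i-1}{p-1}\binom{n}{p},$$ and the number of FC elements of size $p$ ending with $\sigma_j$ is $$\frac{j}{n+1-p}\binom{n-j}{p-1}\binom{n}{p}.$$ 3. For $1\le i\le j\le n$, the number of FC elements starting with $\sigma_i$ and ending with $\sigma_j$ is $\binom{n-j+i-1}{i-1}$. For $2\le i\le n$, the number of FC elements starting with $\sigma_i$ and ending with $\sigma_{i-1}$ is $\binom{n}{i-1}-1$. -/

import Mathlib

namespace FCTypeA

section FullyCommutative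

variable {B W : Type*} [Group W] {M : CoxeterMatrix B}

/-- One commutation move on words: two adjacent letters `s`, `t` with `m_{st} = 2` are exchanged. -/
def CommMove (M : CoxeterMatrix B) (u v : List B) : Prop :=
  ∃ (a b : List B) (s t : B), M s t = 2 ∧ u = a ++ [s, t] ++ b ∧ v = a ++ [t, s] ++ b

/-- `w` is fully commutative: any reduced expression of `w` can be obtained from any other one
using only commutation moves. -/
def IsFC (cs : CoxeterSystem M W) (w : W) : Prop :=
  ∀ u v : List B, cs.IsReduced u → cs.IsReduced v → cs.wordProd u = w → cs.wordProd v = w →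
    Relation.ReflTransGen (CommMove M) u v

end FullyCommutative

/-- The word `σ_i σ_{i+1} ⋯ σ_j` written `[i, j]`. Generators are numbered `1, …, n`; the generator
`σ_k` is the simple reflection with index `k - 1` in `Fin n`. -/
def block (n i j : ℕ) : List (Fin n) :=
  (List.finRange n).filter fun k => i ≤ (k : ℕ) + 1 ∧ (k : ℕ) + 1 ≤ j

/-- Standard `p`-pairs `(i_1, j_1), …, (i_p, j_p)` (where `p` is the length of the list):
`1 ≤ i_t ≤ j_t ≤ n` for all `t`, `i_1 > ⋯ > i_p` and `j_1 > ⋯ > j_p`. -/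
def IsStandard (n : ℕ) (L : List (ℕ × ℕ)) : Prop :=
  (∀ a ∈ L, 1 ≤ a.1 ∧ a.1 ≤ a.2 ∧ a.2 ≤ n) ∧
    L.Pairwise fun a b => b.1 < a.1 ∧ b.2 < a.2

/-- The word `[i_1, j_1] [i_2, j_2] ⋯ [i_p, j_p]`. -/
def canonicalWord (n : ℕ) (L : List (ℕ × ℕ)) : List (Fin n) :=
  L.flatMap fun a => block n a.1 a.2

variable {W : Type*} [Group W] {n : ℕ}

/-- `[i_1, j_1] ⋯ [i_p, j_p]` is a canonical form of `w`. -/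
def IsCanonicalForm (cs : CoxeterSystem (CoxeterMatrix.A n) W) (w : W) (L : List (ℕ × ℕ)) : Prop :=
  IsStandard n L ∧ cs.wordProd (canonicalWord n L) = w

/-- The fully commutative elements of `W(A_n)` whose canonical form satisfies `P`. -/
def fcWith (cs : CoxeterSystem (CoxeterMatrix.A n) W) (P : List (ℕ × ℕ) → Prop) : Set W :=
  {w | IsFC cs w ∧ ∃ L, IsCanonicalForm cs w L ∧ P L}

/-- The first block is `[i, j]`, that is, `(i_1, j_1) = (i, j)`. -/
def FirstBlock (i j : ℕ) (L : List (ℕ × ℕ)) : Prop := L.head? = some (i, j)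

/-- The last block is `[i, j]`, that is, `(i_p, j_p) = (i, j)`. -/
def LastBlock (i j : ℕ) (L : List (ℕ × ℕ)) : Prop := L.getLast? = some (i, j)

/-- The canonical word starts with `σ_i` on the left: `i_1 = i`. -/
def StartsWith (i : ℕ) (L : List (ℕ × ℕ)) : Prop := ∃ j, FirstBlock i j L

/-- The canonical word ends with `σ_j` on the right: `j_p = j`. -/
def EndsWith (j : ℕ) (L : List (ℕ × ℕ)) : Prop := ∃ i, LastBlock i j L

end FCTypeA

/-!
Every product of generators is rewritten, one letter at a time from the right, as a product of
blocks `[i_1, j_1] ⋯ [i_p, j_p]` with `j_1 > ⋯ > j_p` but arbitrary `i_t`. Letting `σ_k` act as the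
transposition of `k` and `k + 1`, the largest number that is moved is `j_1 + 1`, and it goes to
`i_1`; hence such a product determines its blocks. A braid relation used in the rewriting puts
the `i_t` out of order for good and a cancellation shortens the word, so when a reduced word has a
normal form with `i_1 > ⋯ > i_p`, only commutations have been used. Therefore the products of
standard lists of blocks are fully commutative and pairwise distinct.

The standard lists are counted with separate bounds `i_t ≤ a` and `j_t ≤ b`. Those attaining
neither, one or both of the bounds are related by inclusion-exclusion, and removing the first block
from a list attaining both gives any list with bounds `a - 1` and `b - 1`. This recursion on the
staircase `a ≤ b + 1` is solved by differences of products of binomial coefficients. Inversion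
followed by the symmetry of the Coxeter diagram turns the statements about first blocks into those
about last blocks.
-/

namespace FCTypeA

section CommEquiv

variable {B : Type*} {M : CoxeterMatrix B} {u v : List B}

/-- Equality of words up to commutation moves: `CommMove` is symmetric, so this is the equivalence
relation whose classes are the commutation classes. -/
abbrev CommEquiv (M : CoxeterMatrix B) : List B → List B → Prop :=
  Relation.ReflTransGen (CommMove M)

theorem CommMove.symm (h : CommMove M u v) : CommMove M v u := by
  obtain ⟨a, b, s, t, hst, rfl, rfl⟩ := h
  exact ⟨a, b, t, s, by rwa [M.symmetric], rfl, rfl⟩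

theorem CommEquiv.symm (h : CommEquiv M u v) : CommEquiv M v u :=
  have : Std.Symm (CommMove M) := ⟨fun _ _ => CommMove.symm⟩
  Relation.ReflTransGen.stdSymm.symm _ _ h

theorem CommEquiv.append_left (h : CommEquiv M u v) (a : List B) :
    CommEquiv M (a ++ u) (a ++ v) := by
  refine h.lift (a ++ ·) ?_
  rintro _ _ ⟨b, d, s, t, hst, rfl, rfl⟩
  exact ⟨a ++ b, d, s, t, hst, by simp, by simp⟩

theorem CommEquiv.append_right (h : CommEquiv M u v) (b : List B) :
    CommEquiv M (u ++ b) (v ++ b) := by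
  refine h.lift (· ++ b) ?_
  rintro _ _ ⟨a, d, s, t, hst, rfl, rfl⟩
  exact ⟨a, d ++ b, s, t, hst, by simp, by simp⟩

theorem commEquiv_cons_append_singleton {c : B} (h : ∀ t ∈ u, M c t = 2) :
    CommEquiv M (c :: u) (u ++ [c]) := by
  induction u with
  | nil => exact .refl
  | cons t u ih =>
    rw [List.forall_mem_cons] at h
    exact .head ⟨[], u, c, t, h.1, rfl, rfl⟩ ((ih h.2).append_left [t])

theorem commEquiv_append_comm (h : ∀ s ∈ u, ∀ t ∈ v, M s t = 2) :
    CommEquiv M (u ++ v) (v ++ u) := by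
  induction u with
  | nil => simpa using Relation.ReflTransGen.refl
  | cons s u ih =>
    rw [List.forall_mem_cons] at h
    have hs := (commEquiv_cons_append_singleton h.1).append_right u
    exact ((ih h.2).append_left [s]).trans (by simpa using hs)

theorem CommEquiv.wordProd_eq {W : Type*} [Group W] (cs : CoxeterSystem M W)
    (h : CommEquiv M u v) : cs.wordProd u = cs.wordProd v := by
  induction h with
  | refl => rfl
  | tail _ h ih =>
    obtain ⟨a, b, s, t, hst, rfl, rfl⟩ := h
    have hcomm := cs.wordProd_braidWord_eq s t
    simp only [CoxeterSystem.braidWord, M.symmetric t s, hst, CoxeterSystem.alternatingWord,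
      List.concat_eq_append, List.nil_append, List.singleton_append] at hcomm
    rw [ih, cs.wordProd_append, cs.wordProd_append, hcomm, ← cs.wordProd_append,
      ← cs.wordProd_append]

end CommEquiv

section Blocks

variable {n i j k l : ℕ}

theorem mem_block {s : Fin n} : s ∈ block n i j ↔ i ≤ (s : ℕ) + 1 ∧ (s : ℕ) + 1 ≤ j := by
  simp [block]

theorem pairwise_lt_block (n i j : ℕ) : (block n i j).Pairwise (· < ·) :=
  (List.pairwise_lt_finRange n).filter _

theorem block_append_block (hik : i ≤ k + 1) (hkj : k ≤ j) :
    block n i k ++ block n (k + 1) j = block n i j := by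
  refine List.Pairwise.eq_of_mem_iff (r := (· < ·)) ?_ (pairwise_lt_block n i j) ?_
  · refine List.pairwise_append.2 ⟨pairwise_lt_block _ _ _, pairwise_lt_block _ _ _, ?_⟩
    simp only [mem_block, Fin.lt_def]
    omega
  · simp only [List.mem_append, mem_block]
    omega

theorem block_self (s : Fin n) : block n (s + 1) (s + 1) = [s] := by
  refine List.Pairwise.eq_of_mem_iff (r := (· < ·)) (pairwise_lt_block n _ _) (by simp) ?_
  simp only [mem_block, List.mem_singleton, Fin.ext_iff]
  omega

theorem block_self_eq_nil (h : ∀ s : Fin n, (s : ℕ) + 1 ≠ i) : block n i i = [] := by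
  simp only [List.eq_nil_iff_forall_not_mem, mem_block]
  exact fun s hs => h s (by omega)

theorem length_block_self_le (n i : ℕ) : (block n i i).length ≤ 1 := by
  by_cases h : ∃ s : Fin n, (s : ℕ) + 1 = i
  · obtain ⟨s, rfl⟩ := h
    rw [block_self, List.length_singleton]
  · simp [block_self_eq_nil fun s hs => h ⟨s, hs⟩]

theorem canonicalWord_cons (n i j : ℕ) (L : List (ℕ × ℕ)) :
    canonicalWord n ((i, j) :: L) = block n i j ++ canonicalWord n L :=
  List.flatMap_cons

theorem coxeterMatrix_A_apply (s t : Fin n) :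
    CoxeterMatrix.A n s t =
      if s = t then 1 else if (t : ℕ) + 1 = s ∨ (s : ℕ) + 1 = t then 3 else 2 :=
  rfl

theorem coxeterMatrix_A_eq_two {s t : Fin n} (h : (s : ℕ) + 1 < t) :
    CoxeterMatrix.A n s t = 2 := by
  rw [coxeterMatrix_A_apply, if_neg (by omega), if_neg (by omega)]

theorem coxeterMatrix_A_eq_three {s t : Fin n} (h : (s : ℕ) + 1 = t) :
    CoxeterMatrix.A n s t = 3 := by
  rw [coxeterMatrix_A_apply, if_neg (by omega), if_pos (.inr h)]

theorem commEquiv_block_append_block (h : j + 1 < k) :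
    CommEquiv (CoxeterMatrix.A n) (block n i j ++ block n k l) (block n k l ++ block n i j) := by
  refine commEquiv_append_comm fun s hs t ht => coxeterMatrix_A_eq_two ?_
  rw [mem_block] at hs ht
  omega

end Blocks

section BlockProd

variable {W : Type*} [Group W] {n i j k l d c : ℕ} (cs : CoxeterSystem (CoxeterMatrix.A n) W)

/-- The element `σ_i σ_{i+1} ⋯ σ_j` of the Coxeter group; it is `1` when `j < i`, and `σ_c` when
`i = j = c` with `1 ≤ c ≤ n`. -/
def blockProd (i j : ℕ) : W := cs.wordProd (block n i j)

theorem wordProd_canonicalWord_cons (i j : ℕ) (L : List (ℕ × ℕ)) :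
    cs.wordProd (canonicalWord n ((i, j) :: L)) =
      blockProd cs i j * cs.wordProd (canonicalWord n L) := by
  rw [canonicalWord_cons, cs.wordProd_append, blockProd]

theorem blockProd_self (s : Fin n) : blockProd cs (s + 1) (s + 1) = cs.simple s := by
  rw [blockProd, block_self, cs.wordProd_singleton]

theorem blockProd_mul_blockProd (hik : i ≤ k + 1) (hkj : k ≤ j) :
    blockProd cs i k * blockProd cs (k + 1) j = blockProd cs i j := by
  rw [blockProd, blockProd, ← cs.wordProd_append, block_append_block hik hkj, blockProd]

theorem blockProd_mul_comm (h : j + 1 < k) :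
    blockProd cs i j * blockProd cs k l = blockProd cs k l * blockProd cs i j := by
  simp only [blockProd, ← cs.wordProd_append]
  exact (commEquiv_block_append_block h).wordProd_eq cs

theorem blockProd_self_mul_self (i : ℕ) : blockProd cs i i * blockProd cs i i = 1 := by
  by_cases h : ∃ s : Fin n, (s : ℕ) + 1 = i
  · obtain ⟨s, rfl⟩ := h
    rw [blockProd_self, cs.simple_mul_simple_self]
  · simp [blockProd, block_self_eq_nil fun s hs => h ⟨s, hs⟩]

theorem blockProd_braid (hc : 1 ≤ c) (hcn : c + 1 ≤ n) :
    blockProd cs (c + 1) (c + 1) * blockProd cs c c * blockProd cs (c + 1) (c + 1) =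
      blockProd cs c c * blockProd cs (c + 1) (c + 1) * blockProd cs c c := by
  obtain ⟨c, rfl⟩ : ∃ b, c = b + 1 := ⟨c - 1, by omega⟩
  let s : Fin n := ⟨c, by omega⟩
  let t : Fin n := ⟨c + 1, by omega⟩
  have hbraid := cs.wordProd_braidWord_eq s t
  simp only [CoxeterSystem.braidWord, (CoxeterMatrix.A n).symmetric t s,
    coxeterMatrix_A_eq_three (s := s) (t := t) rfl] at hbraid
  simp only [CoxeterSystem.alternatingWord, List.concat_eq_append, cs.wordProd_append,
    cs.wordProd_nil, cs.wordProd_singleton, one_mul] at hbraid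
  rw [blockProd_self cs s, blockProd_self cs t]
  exact hbraid

theorem blockProd_self_succ_mul_blockProd (hid : i ≤ d + 1) (hdj : d + 2 ≤ j)
    (hj : j ≤ n) :
    blockProd cs (d + 2) (d + 2) * blockProd cs i j =
      blockProd cs i j * blockProd cs (d + 1) (d + 1) := by
  have hsplit : blockProd cs i j = blockProd cs i d *
      (blockProd cs (d + 1) (d + 1) * blockProd cs (d + 2) (d + 2)) * blockProd cs (d + 3) j := by
    rw [blockProd_mul_blockProd cs (by omega) (by omega),
      blockProd_mul_blockProd cs hid (by omega), blockProd_mul_blockProd cs (by omega) hdj]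
  have hleft := blockProd_mul_comm cs (i := i) (j := d) (k := d + 2) (l := d + 2) (by omega)
  have hright := blockProd_mul_comm cs (i := d + 1) (j := d + 1) (k := d + 3) (l := j) (by omega)
  have hbraid := blockProd_braid cs (c := d + 1) (by omega) (by omega)
  calc blockProd cs (d + 2) (d + 2) * blockProd cs i j
      = blockProd cs i d * (blockProd cs (d + 2) (d + 2) * blockProd cs (d + 1) (d + 1) *
          blockProd cs (d + 2) (d + 2)) * blockProd cs (d + 3) j := by
        rw [hsplit]; simp only [← mul_assoc, hleft]
    _ = blockProd cs i j * blockProd cs (d + 1) (d + 1) := by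
        rw [hbraid, hsplit]; simp only [mul_assoc, hright]

end BlockProd

section Representation

variable {W : Type*} [Group W] {n i j x : ℕ} (cs : CoxeterSystem (CoxeterMatrix.A n) W)

theorem mul_pow_three_eq_one {G : Type*} [Group G] {a b : G} (ha : a * a = 1) (hb : b * b = 1)
    (h : a * b * a = b * a * b) : (a * b) ^ 3 = 1 :=
  calc
    (a * b) ^ 3 = (a * b * a) * (b * a * b) := by
      simp only [pow_succ, pow_zero, one_mul, mul_assoc]
    _ = a * b * (a * a) * b * a := by rw [← h]; simp only [mul_assoc]
    _ = 1 := by rw [ha, mul_one, mul_assoc a b b, hb, mul_one, ha]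

theorem swap_succ_braid (a : ℕ) :
    Equiv.swap a (a + 1) * Equiv.swap (a + 1) (a + 2) * Equiv.swap a (a + 1) =
      Equiv.swap (a + 1) (a + 2) * Equiv.swap a (a + 1) * Equiv.swap (a + 1) (a + 2) := by
  rw [Equiv.swap_mul_swap_mul_swap (by omega) (by omega), Equiv.swap_comm a (a + 1),
    Equiv.swap_comm (a + 1) (a + 2), Equiv.swap_mul_swap_mul_swap (by omega) (by omega),
    Equiv.swap_comm]

theorem isLiftable_swap (n : ℕ) :
    (CoxeterMatrix.A n).IsLiftable fun s : Fin n => Equiv.swap ((s : ℕ) + 1) (s + 2) := by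
  intro s t
  wlog hst : s ≤ t generalizing s t
  · rw [← inv_eq_one, ← inv_pow, mul_inv_rev, Equiv.swap_inv, Equiv.swap_inv,
      (CoxeterMatrix.A n).symmetric]
    exact this t s (by omega)
  rcases hst.eq_or_lt with rfl | hlt
  · simp
  rcases (Nat.succ_le_of_lt hlt).eq_or_lt with hsucc | hlt
  · rw [coxeterMatrix_A_eq_three hsucc]
    refine mul_pow_three_eq_one (by simp) (by simp) ?_
    simpa only [← hsucc] using swap_succ_braid (s + 1)
  · have hdisj := Equiv.Perm.disjoint_swap_swap
      (show [(s : ℕ) + 1, s + 2, t + 1, t + 2].Nodup by simp; omega)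
    rw [coxeterMatrix_A_eq_two hlt, hdisj.commute.mul_pow]
    simp [pow_two]

/-- The action of `W(A_n)` on positions: `σ_k` exchanges `k` and `k + 1`. Letting it act on all of
`ℕ`, rather than on `{1, …, n + 1}`, avoids casts. -/
noncomputable def permRep : W →* Equiv.Perm ℕ := cs.lift ⟨_, isLiftable_swap n⟩

theorem permRep_simple (s : Fin n) :
    permRep cs (cs.simple s) = Equiv.swap ((s : ℕ) + 1) (s + 2) :=
  cs.lift_apply_simple (isLiftable_swap n) s

theorem permRep_wordProd_apply_of_lt {v : List (Fin n)} (h : ∀ s ∈ v, (s : ℕ) + 2 < x) :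
    permRep cs (cs.wordProd v) x = x := by
  induction v with
  | nil => simp
  | cons s v ih =>
    rw [List.forall_mem_cons] at h
    rw [cs.wordProd_cons, map_mul, Equiv.Perm.mul_apply, ih h.2, permRep_simple,
      Equiv.swap_apply_of_ne_of_ne (by omega) (by omega)]

theorem permRep_blockProd_apply (hi : 1 ≤ i) (hij : i ≤ j) (hj : j ≤ n) :
    permRep cs (blockProd cs i j) (j + 1) = i := by
  obtain ⟨k, rfl⟩ : ∃ k, i = k + 1 := ⟨i - 1, by omega⟩
  induction j, hij using Nat.le_induction with
  | base =>
    rw [blockProd_self cs ⟨k, hj⟩, permRep_simple, Equiv.swap_apply_right]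
  | succ j hkj ih =>
    rw [← blockProd_mul_blockProd cs (k := j) (by omega) (by omega), blockProd_self cs ⟨j, hj⟩,
      map_mul, Equiv.Perm.mul_apply, permRep_simple, Equiv.swap_apply_right]
    exact ih (by omega)

end Representation

section NormalForm

variable {W : Type*} [Group W] {n a a' b b' i j m m' : ℕ} {L L' : List (ℕ × ℕ)}
  (cs : CoxeterSystem (CoxeterMatrix.A n) W)

/-- Normal forms of arbitrary elements of `W(A_n)`: blocks `[i_1, j_1] ⋯ [i_p, j_p]` with
`1 ≤ i_t ≤ j_t` and `m ≥ j_1 > ⋯ > j_p`. Unlike in `IsStandard`, nothing is required of the order of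
the `i_t`. -/
def IsNormalForm : ℕ → List (ℕ × ℕ) → Prop
  | _, [] => True
  | m, (i, j) :: L => 1 ≤ i ∧ i ≤ j ∧ j ≤ m ∧ IsNormalForm (j - 1) L

theorem IsNormalForm.mono (hm : m ≤ m') (hL : IsNormalForm m L) : IsNormalForm m' L := by
  cases L with
  | nil => trivial
  | cons x L => exact ⟨hL.1, hL.2.1, hL.2.2.1.trans hm, hL.2.2.2⟩

theorem isStandard_cons : IsStandard n ((i, j) :: L) ↔
    (1 ≤ i ∧ i ≤ j ∧ j ≤ n) ∧ (∀ x ∈ L, x.1 < i ∧ x.2 < j) ∧ IsStandard n L := by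
  simp only [IsStandard, List.forall_mem_cons, List.pairwise_cons]
  tauto

/-- The standard lists of blocks `[i, j]` with `i ≤ a` and `j ≤ b`. Bounding the two coordinates
separately makes the family closed under removal of the first block. -/
def standardBelow (a b : ℕ) : Set (List (ℕ × ℕ)) :=
  {L | IsStandard b L ∧ ∀ x ∈ L, x.1 ≤ a}

theorem nil_mem_standardBelow (a b : ℕ) : [] ∈ standardBelow a b := by
  simp [standardBelow, IsStandard]

theorem cons_mem_standardBelow : (i, j) :: L ∈ standardBelow a b ↔
    1 ≤ i ∧ i ≤ j ∧ i ≤ a ∧ j ≤ b ∧ L ∈ standardBelow (i - 1) (j - 1) := by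
  constructor
  · rintro ⟨hL, ha⟩
    obtain ⟨⟨hi, hij, hj⟩, hlt, hL⟩ := isStandard_cons.1 hL
    refine ⟨hi, hij, ha _ List.mem_cons_self, hj, ⟨fun x hx => ?_, hL.2⟩, fun x hx => ?_⟩
    · have := hlt x hx
      have := hL.1 x hx
      omega
    · exact Nat.le_sub_one_of_lt (hlt x hx).1
  · rintro ⟨hi, hij, ha, hj, hL, hLi⟩
    refine ⟨isStandard_cons.2 ⟨⟨hi, hij, hj⟩, fun x hx => ?_, fun x hx => ?_, hL.2⟩,
      List.forall_mem_cons.2 ⟨ha, fun x hx => ?_⟩⟩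
    all_goals
      have := hL.1 x hx
      have := hLi x hx
      omega

theorem standardBelow_mono (ha : a ≤ a') (hb : b ≤ b') : standardBelow a b ⊆ standardBelow a' b' :=
  fun _ hL => ⟨⟨fun x hx => (hL.1.1 x hx).imp_right (.imp_right (.trans · hb)), hL.1.2⟩,
    fun x hx => (hL.2 x hx).trans ha⟩

theorem mem_standardBelow_self : L ∈ standardBelow n n ↔ IsStandard n L :=
  and_iff_left_of_imp fun hL x hx => (hL.1 x hx).2.1.trans (hL.1 x hx).2.2

theorem isNormalForm_of_mem_standardBelow (hL : L ∈ standardBelow a b) : IsNormalForm b L := by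
  induction L generalizing a b with
  | nil => trivial
  | cons x L ih =>
    obtain ⟨hi, hij, -, hj, hL⟩ := cons_mem_standardBelow.1 hL
    exact ⟨hi, hij, hj, ih hL⟩

theorem lt_of_mem_canonicalWord {s : Fin n} (hL : IsNormalForm m L) (hs : s ∈ canonicalWord n L) :
    (s : ℕ) < m := by
  induction L generalizing m with
  | nil => simp [canonicalWord] at hs
  | cons x L ih =>
    obtain ⟨hi, hij, hj, hL⟩ := hL
    rw [canonicalWord_cons, List.mem_append, mem_block] at hs
    rcases hs with hs | hs
    · omega
    · have := ih hL hs
      omega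

theorem permRep_canonicalWord_apply_of_lt (hL : IsNormalForm m L) {x : ℕ} (hx : m + 1 < x) :
    permRep cs (cs.wordProd (canonicalWord n L)) x = x :=
  permRep_wordProd_apply_of_lt cs fun s hs => by
    have := lt_of_mem_canonicalWord hL hs
    omega

theorem permRep_canonicalWord_cons_apply (hL : IsNormalForm n ((i, j) :: L)) :
    permRep cs (cs.wordProd (canonicalWord n ((i, j) :: L))) (j + 1) = i := by
  obtain ⟨hi, hij, hj, hL⟩ := hL
  rw [wordProd_canonicalWord_cons, map_mul, Equiv.Perm.mul_apply,
    permRep_canonicalWord_apply_of_lt cs hL (by omega), permRep_blockProd_apply cs hi hij hj]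

theorem le_of_wordProd_canonicalWord_eq (hL : IsNormalForm m L)
    (hL' : IsNormalForm n ((i, j) :: L'))
    (h : cs.wordProd (canonicalWord n L) = cs.wordProd (canonicalWord n ((i, j) :: L'))) :
    j ≤ m := by
  by_contra! hmj
  have himage := permRep_canonicalWord_cons_apply cs hL'
  rw [← h, permRep_canonicalWord_apply_of_lt cs hL (by omega)] at himage
  have := hL'.2.1
  omega

theorem IsNormalForm.eq_of_wordProd_eq (hL : IsNormalForm n L) (hL' : IsNormalForm n L')
    (h : cs.wordProd (canonicalWord n L) = cs.wordProd (canonicalWord n L')) : L = L' := by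
  induction L generalizing L' with
  | nil =>
    rcases L' with _ | ⟨⟨i, j⟩, L'⟩
    · rfl
    · have := le_of_wordProd_canonicalWord_eq cs (L := []) (m := 0) trivial hL' h
      have := hL'.1.trans hL'.2.1
      omega
  | cons x L ih =>
    obtain ⟨i, j⟩ := x
    have hL₀ : IsNormalForm j ((i, j) :: L) := ⟨hL.1, hL.2.1, le_rfl, hL.2.2.2⟩
    rcases L' with _ | ⟨⟨i', j'⟩, L'⟩
    · have := le_of_wordProd_canonicalWord_eq cs (L := []) (m := 0) trivial hL h.symm
      have := hL.1.trans hL.2.1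
      omega
    have hL₀' : IsNormalForm j' ((i', j') :: L') := ⟨hL'.1, hL'.2.1, le_rfl, hL'.2.2.2⟩
    obtain rfl : j = j' := (le_of_wordProd_canonicalWord_eq cs hL₀' hL h.symm).antisymm
      (le_of_wordProd_canonicalWord_eq cs hL₀ hL' h)
    obtain rfl : i = i' := by
      rw [← permRep_canonicalWord_cons_apply cs hL, h, permRep_canonicalWord_cons_apply cs hL']
    simp only [wordProd_canonicalWord_cons, mul_right_inj] at h
    have htail : j - 1 ≤ n := (Nat.sub_le _ _).trans hL.2.2.1
    rw [ih (hL.2.2.2.mono htail) (hL'.2.2.2.mono htail) h]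

end NormalForm

section Insertion

variable {W : Type*} [Group W] {n a c m : ℕ} {L : List (ℕ × ℕ)}
  (cs : CoxeterSystem (CoxeterMatrix.A n) W)

/-- The normal form of `σ_c w`, where `L` is the normal form of `w`: the letter `σ_c` is moved to
the right past the blocks, by a braid relation when `i < c ≤ j`, until it is absorbed. -/
def insertLetter : ℕ → List (ℕ × ℕ) → List (ℕ × ℕ)
  | c, [] => [(c, c)]
  | c, (i, j) :: L =>
    if j < c then (c, c) :: (i, j) :: L
    else if i < c then (i, j) :: insertLetter (c - 1) L
    else if i = c then if c < j then (c + 1, j) :: L else L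
    else if i = c + 1 then (c, j) :: L
    else (i, j) :: insertLetter c L

theorem isNormalForm_insertLetter (hL : IsNormalForm m L) (hc : 1 ≤ c) (hcm : c ≤ m) :
    IsNormalForm m (insertLetter c L) := by
  fun_induction insertLetter c L generalizing m with
  | case1 => exact ⟨hc, le_rfl, hcm, trivial⟩
  | case2 c i j L hjc => exact ⟨hc, le_rfl, hcm, hL.1, hL.2.1, Nat.le_sub_one_of_lt hjc, hL.2.2.2⟩
  | case3 c i j L _ _ ih =>
    obtain ⟨hi, hij, hj, hL⟩ := hL
    exact ⟨hi, hij, hj, ih hL (by omega) (by omega)⟩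
  | case4 i j L _ _ hij => exact ⟨by omega, hij, hL.2.2⟩
  | case5 i j L => exact hL.2.2.2.mono ((Nat.sub_le _ _).trans hL.2.2.1)
  | case6 c j L => exact ⟨hc, by omega, hL.2.2⟩
  | case7 c i j L _ _ _ _ ih =>
    obtain ⟨hi, hij, hj, hL⟩ := hL
    exact ⟨hi, hij, hj, ih hL hc (by omega)⟩

theorem wordProd_canonicalWord_insertLetter (hL : IsNormalForm m L) (hmn : m ≤ n) :
    cs.wordProd (canonicalWord n (insertLetter c L)) =
      blockProd cs c c * cs.wordProd (canonicalWord n L) := by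
  fun_induction insertLetter c L generalizing m with
  | case1 | case2 => exact wordProd_canonicalWord_cons ..
  | case3 c i j L _ _ ih =>
    obtain ⟨hi, -, hj, hL⟩ := hL
    obtain ⟨d, rfl⟩ : ∃ d, c = d + 2 := ⟨c - 2, by omega⟩
    rw [wordProd_canonicalWord_cons, ih hL (by omega), wordProd_canonicalWord_cons,
      ← mul_assoc, ← mul_assoc,
      blockProd_self_succ_mul_blockProd cs (by omega) (by omega) (by omega)]
    rfl
  | case4 i j L =>
    rw [wordProd_canonicalWord_cons, wordProd_canonicalWord_cons,
      ← blockProd_mul_blockProd cs (i := i) (j := j) (k := i) (by omega) (by omega), ← mul_assoc,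
      ← mul_assoc, blockProd_self_mul_self, one_mul]
  | case5 i j L =>
    obtain rfl : i = j := by omega
    rw [wordProd_canonicalWord_cons, ← mul_assoc, blockProd_self_mul_self, one_mul]
  | case6 c j L =>
    obtain ⟨-, hcj, -⟩ := hL
    rw [wordProd_canonicalWord_cons, wordProd_canonicalWord_cons, ← mul_assoc,
      blockProd_mul_blockProd cs (by omega) (by omega)]
  | case7 c i j L _ _ _ _ ih =>
    obtain ⟨hi, hij, hj, hL⟩ := hL
    rw [wordProd_canonicalWord_cons, ih hL (by omega), wordProd_canonicalWord_cons,
      ← mul_assoc, ← mul_assoc, blockProd_mul_comm cs (i := c) (j := c) (by omega)]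

theorem length_canonicalWord_insertLetter_le (n c : ℕ) (L : List (ℕ × ℕ)) :
    (canonicalWord n (insertLetter c L)).length ≤ (canonicalWord n L).length + 1 := by
  have hself := length_block_self_le n c
  fun_induction insertLetter c L with
  | case1 => simpa [canonicalWord] using hself
  | case2 c i j L =>
    rw [canonicalWord_cons n c c, List.length_append]
    omega
  | case3 c i j L _ _ ih =>
    have := ih (length_block_self_le n _)
    simp only [canonicalWord_cons, List.length_append] at this ⊢
    omega
  | case4 i j L =>
    rw [canonicalWord_cons, canonicalWord_cons,
      ← block_append_block (i := i) (j := j) (k := i) (by omega) (by omega)]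
    simp only [List.length_append]
    omega
  | case5 i j L =>
    rw [canonicalWord_cons, List.length_append]
    omega
  | case6 c j L =>
    rw [canonicalWord_cons, canonicalWord_cons,
      ← block_append_block (i := c) (j := j) (k := c) (by omega) (by omega)]
    simp only [List.length_append]
    omega
  | case7 c i j L _ _ _ _ ih =>
    simp only [canonicalWord_cons, List.length_append] at ih ⊢
    omega

/-- The braid and cancellation branches of `insertLetter` are incompatible with the assumptions:
the first yields blocks whose left ends do not decrease, the second shortens the word. -/
theorem commEquiv_canonicalWord_insertLetter (hL : IsNormalForm m L)
    (hlen : (canonicalWord n L).length < (canonicalWord n (insertLetter c L)).length)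
    (hins : insertLetter c L ∈ standardBelow a m) :
    c ≤ a ∧ L ∈ standardBelow (max a (c + 1)) m ∧
      CommEquiv (CoxeterMatrix.A n) (block n c c ++ canonicalWord n L)
        (canonicalWord n (insertLetter c L)) := by
  fun_induction insertLetter c L generalizing a m with
  | case1 c =>
    exact ⟨(cons_mem_standardBelow.1 hins).2.2.1, nil_mem_standardBelow _ _, .refl⟩
  | case2 c i j L =>
    obtain ⟨hc, -, hca, hcm, hL⟩ := cons_mem_standardBelow.1 hins
    exact ⟨hca, standardBelow_mono (by omega) (by omega) hL, .refl⟩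
  | case3 c i j L _ _ ih =>
    simp only [canonicalWord_cons, List.length_append, add_lt_add_iff_left] at hlen
    have := (ih hL.2.2.2 hlen (cons_mem_standardBelow.1 hins).2.2.2.2).1
    have := hL.1
    omega
  | case4 i j L =>
    rw [canonicalWord_cons, canonicalWord_cons,
      ← block_append_block (i := i) (j := j) (k := i) (by omega) (by omega)] at hlen
    simp only [List.length_append] at hlen
    omega
  | case5 i j L =>
    rw [canonicalWord_cons, List.length_append] at hlen
    omega
  | case6 c j L =>
    obtain ⟨hc, hcj, hca, hjm, hL'⟩ := cons_mem_standardBelow.1 hins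
    refine ⟨hca, cons_mem_standardBelow.2 ⟨by omega, hL.2.1, by omega, hjm,
      standardBelow_mono (by omega) le_rfl hL'⟩, ?_⟩
    rw [canonicalWord_cons, canonicalWord_cons, ← List.append_assoc,
      block_append_block (by omega) (by omega)]
  | case7 c i j L _ _ _ _ ih =>
    obtain ⟨hi, hij, hia, hjm, hL'⟩ := cons_mem_standardBelow.1 hins
    simp only [canonicalWord_cons, List.length_append, add_lt_add_iff_left] at hlen
    obtain ⟨hci, hLi, hequiv⟩ := ih hL.2.2.2 hlen hL'
    refine ⟨by omega, cons_mem_standardBelow.2 ⟨hi, hij, by omega, hjm,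
      standardBelow_mono (by omega) le_rfl hLi⟩, ?_⟩
    have hcomm : CommEquiv (CoxeterMatrix.A n) (block n c c ++ block n i j)
      (block n i j ++ block n c c) := commEquiv_block_append_block (by omega)
    rw [canonicalWord_cons, canonicalWord_cons, ← List.append_assoc]
    refine (hcomm.append_right _).trans ?_
    rw [List.append_assoc]
    exact hequiv.append_left _

/-- The normal form of the product of a word, computed letter by letter from the right. -/
def normalForm (v : List (Fin n)) : List (ℕ × ℕ) :=
  v.foldr (fun s L => insertLetter (s + 1) L) []

theorem isNormalForm_normalForm (v : List (Fin n)) : IsNormalForm n (normalForm v) := by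
  induction v with
  | nil => trivial
  | cons s v ih => exact isNormalForm_insertLetter ih (by omega) s.isLt

theorem wordProd_canonicalWord_normalForm (v : List (Fin n)) :
    cs.wordProd (canonicalWord n (normalForm v)) = cs.wordProd v := by
  induction v with
  | nil => rfl
  | cons s v ih =>
    rw [cs.wordProd_cons, ← ih, ← blockProd_self]
    exact wordProd_canonicalWord_insertLetter cs (isNormalForm_normalForm v) le_rfl

theorem length_canonicalWord_normalForm_le (v : List (Fin n)) :
    (canonicalWord n (normalForm v)).length ≤ v.length := by
  induction v with
  | nil => simp [normalForm, canonicalWord]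
  | cons s v ih =>
    exact (length_canonicalWord_insertLetter_le n (s + 1) _).trans (Nat.succ_le_succ ih)

theorem commEquiv_canonicalWord_normalForm {v : List (Fin n)} (hv : cs.IsReduced v)
    (hstd : IsStandard n (normalForm v)) :
    CommEquiv (CoxeterMatrix.A n) v (canonicalWord n (normalForm v)) := by
  induction v with
  | nil => exact .refl
  | cons s v ih =>
    have hlen : (canonicalWord n (normalForm v)).length <
        (canonicalWord n (normalForm (s :: v))).length :=
      calc (canonicalWord n (normalForm v)).length
          < (s :: v).length := Nat.lt_succ_of_le (length_canonicalWord_normalForm_le v)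
        _ = cs.length (cs.wordProd (canonicalWord n (normalForm (s :: v)))) := by
          rw [wordProd_canonicalWord_normalForm, hv]
        _ ≤ (canonicalWord n (normalForm (s :: v))).length := cs.length_wordProd_le _
    obtain ⟨-, hstd', hequiv⟩ := commEquiv_canonicalWord_insertLetter
      (isNormalForm_normalForm v) hlen (mem_standardBelow_self.2 hstd)
    rw [block_self] at hequiv
    exact ((ih (hv.drop 1) hstd'.1).append_left [s]).trans hequiv

theorem isFC_wordProd_canonicalWord (hL : IsStandard n L) :
    IsFC cs (cs.wordProd (canonicalWord n L)) := by
  have hequiv (v : List (Fin n)) (hv : cs.IsReduced v)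
      (hvL : cs.wordProd v = cs.wordProd (canonicalWord n L)) :
      CommEquiv (CoxeterMatrix.A n) v (canonicalWord n L) := by
    obtain rfl : normalForm v = L := (isNormalForm_normalForm v).eq_of_wordProd_eq cs
      (isNormalForm_of_mem_standardBelow (mem_standardBelow_self.2 hL))
      ((wordProd_canonicalWord_normalForm cs v).trans hvL)
    exact commEquiv_canonicalWord_normalForm cs hv hL
  exact fun u v hu hv huL hvL => (hequiv u hu huL).trans (hequiv v hv hvL).symm

theorem ncard_fcWith (P : List (ℕ × ℕ) → Prop) :
    (fcWith cs P).ncard = {L | IsStandard n L ∧ P L}.ncard := by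
  have himage : fcWith cs P =
      (fun L => cs.wordProd (canonicalWord n L)) '' {L | IsStandard n L ∧ P L} := by
    ext w
    constructor
    · rintro ⟨-, L, ⟨hL, rfl⟩, hP⟩
      exact ⟨L, ⟨hL, hP⟩, rfl⟩
    · rintro ⟨L, ⟨hL, hP⟩, rfl⟩
      exact ⟨isFC_wordProd_canonicalWord cs hL, L, ⟨hL, rfl⟩, hP⟩
  rw [himage]
  refine Set.InjOn.ncard_image fun L hL L' hL' h => IsNormalForm.eq_of_wordProd_eq cs ?_ ?_ h
  · exact isNormalForm_of_mem_standardBelow (mem_standardBelow_self.2 hL.1)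
  · exact isNormalForm_of_mem_standardBelow (mem_standardBelow_self.2 hL'.1)

end Insertion

section Counting

variable {a b j : ℕ}

theorem staircase_induction {C : ℕ → ℕ → Prop} (zero : ∀ b, C 0 b)
    (diag : ∀ b, C b b → C (b + 1) b)
    (step : ∀ a b, a ≤ b → C a b → C a (b + 1) → C (a + 1) b → C (a + 1) (b + 1)) :
    ∀ b a, a ≤ b + 1 → C a b := by
  intro b
  induction b with
  | zero =>
    intro a ha
    interval_cases a
    exacts [zero 0, diag 0 (zero 0)]
  | succ b ihb =>
    intro a
    induction a with
    | zero => exact fun _ => zero _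
    | succ a iha =>
      intro ha
      rcases (Nat.le_of_succ_le_succ ha).eq_or_lt with rfl | hab
      · exact diag _ (iha (Nat.le_succ _))
      · exact step a b (by omega) (ihb a (by omega)) (iha (by omega)) (ihb (a + 1) (by omega))

theorem standardBelow_zero (b : ℕ) : standardBelow 0 b = {[]} := by
  refine Set.Subset.antisymm (fun L hL => ?_)
    (Set.singleton_subset_iff.2 (nil_mem_standardBelow 0 b))
  rcases L with _ | ⟨x, L⟩
  · rfl
  · obtain ⟨h1, -, h0, -⟩ := cons_mem_standardBelow.1 hL
    omega

theorem standardBelow_succ_self (b : ℕ) : standardBelow (b + 1) b = standardBelow b b :=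
  Set.Subset.antisymm (fun _ hL => mem_standardBelow_self.2 hL.1)
    (standardBelow_mono (Nat.le_succ b) le_rfl)

theorem standardBelow_succ_succ (hab : a ≤ b) :
    standardBelow (a + 1) (b + 1) = standardBelow a (b + 1) ∪ standardBelow (a + 1) b ∪
      List.cons (a + 1, b + 1) '' standardBelow a b := by
  ext L
  rcases L with _ | ⟨⟨i, j⟩, L⟩
  · simp [nil_mem_standardBelow]
  · simp only [Set.mem_union, Set.mem_image, List.cons.injEq, Prod.mk.injEq,
      cons_mem_standardBelow]
    constructor
    · rintro ⟨hi, hij, hia, hjb, hL⟩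
      by_cases hcorner : i = a + 1 ∧ j = b + 1
      · obtain ⟨rfl, rfl⟩ := hcorner
        exact .inr ⟨L, hL, ⟨rfl, rfl⟩, rfl⟩
      · refine .inl ?_
        simp only [hi, hij, hL, true_and, and_true]
        omega
    · rintro ((⟨hi, hij, hia, hjb, hL⟩ | ⟨hi, hij, hia, hjb, hL⟩) | ⟨L, hL, ⟨rfl, rfl⟩, rfl⟩)
      · exact ⟨hi, hij, by omega, hjb, hL⟩
      · exact ⟨hi, hij, hia, by omega, hL⟩
      · exact ⟨by omega, by omega, le_rfl, le_rfl, hL⟩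

theorem standardBelow_inter (a b : ℕ) :
    standardBelow a (b + 1) ∩ standardBelow (a + 1) b = standardBelow a b :=
  Set.Subset.antisymm (fun _ hL => ⟨hL.2.1, hL.1.2⟩) (Set.subset_inter
    (standardBelow_mono le_rfl (Nat.le_succ b)) (standardBelow_mono (Nat.le_succ a) le_rfl))

theorem finite_standardBelow (hab : a ≤ b + 1) : (standardBelow a b).Finite := by
  refine staircase_induction (C := fun a b => (standardBelow a b).Finite) (fun b => ?_)
    (fun b h => ?_) (fun a b hab h h₁ h₂ => ?_) b a hab
  · exact standardBelow_zero b ▸ Set.finite_singleton []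
  · exact (standardBelow_succ_self b).symm ▸ h
  · exact (standardBelow_succ_succ hab).symm ▸ (h₁.union h₂).union (h.image _)

/-- The number of standard lists of blocks `[i, j]` with `i ≤ a` and `j ≤ b` that satisfy `P`. -/
noncomputable def boundedCount (P : List (ℕ × ℕ) → Prop) (a b : ℕ) : ℕ :=
  (standardBelow a b ∩ {L | P L}).ncard

theorem boundedCount_zero (P : List (ℕ × ℕ) → Prop) [Decidable (P [])] (b : ℕ) :
    boundedCount P 0 b = if P [] then 1 else 0 := by
  rw [boundedCount, standardBelow_zero]
  split_ifs with h
  · exact (congrArg Set.ncard (Set.inter_eq_left.2 (Set.singleton_subset_iff.2 h))).trans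
      (Set.ncard_singleton _)
  · exact (congrArg Set.ncard (Set.singleton_inter_eq_empty.2 h)).trans (Set.ncard_empty _)

theorem boundedCount_succ_self (P : List (ℕ × ℕ) → Prop) (b : ℕ) :
    boundedCount P (b + 1) b = boundedCount P b b := by
  rw [boundedCount, standardBelow_succ_self, boundedCount]

theorem boundedCount_succ_succ (P : List (ℕ × ℕ) → Prop) (hab : a ≤ b) :
    boundedCount P (a + 1) (b + 1) + boundedCount P a b =
      boundedCount P a (b + 1) + boundedCount P (a + 1) b +
        boundedCount (fun L => P ((a + 1, b + 1) :: L)) a b := by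
  have hfin₁ : (standardBelow a (b + 1) ∩ {L | P L}).Finite :=
    (finite_standardBelow (by omega)).inter_of_left _
  have hfin₂ : (standardBelow (a + 1) b ∩ {L | P L}).Finite :=
    (finite_standardBelow (by omega)).inter_of_left _
  have hfin : (List.cons (a + 1, b + 1) '' standardBelow a b ∩ {L | P L}).Finite :=
    ((finite_standardBelow (by omega)).image _).inter_of_left _
  have hcorner : List.cons (a + 1, b + 1) '' standardBelow a b ∩ {L | P L} =
      List.cons (a + 1, b + 1) '' (standardBelow a b ∩ {L | P ((a + 1, b + 1) :: L)}) :=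
    Set.image_inter_preimage _ _ _ |>.symm
  have hdisj : Disjoint (standardBelow a (b + 1) ∩ {L | P L} ∪ standardBelow (a + 1) b ∩ {L | P L})
      (List.cons (a + 1, b + 1) '' standardBelow a b ∩ {L | P L}) := by
    rw [← Set.union_inter_distrib_right]
    refine (Set.disjoint_left.2 ?_).mono Set.inter_subset_left Set.inter_subset_left
    rintro _ hL ⟨L, -, rfl⟩
    simp only [Set.mem_union, cons_mem_standardBelow] at hL
    omega
  simp only [boundedCount]
  rw [standardBelow_succ_succ hab, Set.union_inter_distrib_right, Set.union_inter_distrib_right,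
    Set.ncard_union_eq hdisj (hfin₁.union hfin₂) hfin, hcorner,
    Set.ncard_image_of_injective _ List.cons_injective, ← Set.ncard_union_add_ncard_inter _ _
    hfin₁ hfin₂, ← Set.inter_inter_distrib_right, standardBelow_inter]
  ring

/-- The ballot numbers: for `a ≤ b + 1`, the number of all the standard lists of blocks `[i, j]`
with `i ≤ a` and `j ≤ b` is `ballot a (b + 1)`. -/
def ballot (a b : ℕ) : ℤ :=
  (a + b).choose b - (a + b).choose (b + 1)

theorem ballot_zero (b : ℕ) : ballot 0 b = 1 := by
  simp [ballot]

theorem ballot_succ_self (b : ℕ) : ballot (b + 1) b = 0 := by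
  rw [ballot, Nat.choose_symm_of_eq_add (a := b) (b := b + 1) (by ring), sub_self]

theorem ballot_succ_succ (a b : ℕ) :
    ballot (a + 1) (b + 1) = ballot a (b + 1) + ballot (a + 1) b := by
  simp only [ballot, show a + 1 + (b + 1) = (a + b + 1) + 1 by ring,
    show a + (b + 1) = a + b + 1 by ring, show a + 1 + b = a + b + 1 by ring,
    Nat.choose_succ_succ (a + b + 1), Nat.cast_add]
  ring

theorem boundedCount_true (hab : a ≤ b + 1) :
    (boundedCount (fun _ => True) a b : ℤ) = ballot a (b + 1) := by
  refine staircase_induction (C := fun a b =>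
    (boundedCount (fun _ => True) a b : ℤ) = ballot a (b + 1)) (fun b => ?_) (fun b h => ?_)
    (fun a b hab _ h₁ h₂ => ?_) b a hab
  · simp [boundedCount_zero, ballot_zero]
  · rw [boundedCount_succ_self, h, ballot_succ_succ, ballot_succ_self, add_zero]
  · rw [ballot_succ_succ, ← h₁, ← h₂]
    exact_mod_cast Nat.add_right_cancel (boundedCount_succ_succ (fun _ => True) hab)

/-- The number of standard lists of `p` blocks `[i, j]` with `i ≤ a` and `j ≤ b`, for `a ≤ b + 1`;
it is a Narayana number for `a = b`. -/
def narayana : ℕ → ℕ → ℕ → ℤ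
  | 0, _, _ => 1
  | q + 1, a, b => a.choose (q + 1) * b.choose (q + 1) - a.choose (q + 2) * b.choose q

theorem narayana_zero_left (p b : ℕ) : narayana p 0 b = if p = 0 then 1 else 0 := by
  cases p <;> simp [narayana]

theorem narayana_succ_self (p b : ℕ) : narayana p (b + 1) b = narayana p b b := by
  cases p with
  | zero => rfl
  | succ q =>
    simp only [narayana, Nat.choose_succ_succ' b, Nat.cast_add]
    ring

theorem narayana_succ_succ (q a b : ℕ) : narayana (q + 1) (a + 1) (b + 1) + narayana (q + 1) a b =
    narayana (q + 1) a (b + 1) + narayana (q + 1) (a + 1) b + narayana q a b := by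
  cases q <;>
  · simp only [narayana, Nat.choose_succ_succ' a, Nat.choose_succ_succ' b, Nat.choose_zero_right,
      zero_add, Nat.cast_add, Nat.cast_one]
    ring

theorem boundedCount_length (p : ℕ) (hab : a ≤ b + 1) :
    (boundedCount (·.length = p) a b : ℤ) = narayana p a b := by
  refine staircase_induction (C := fun a b =>
    ∀ p, (boundedCount (·.length = p) a b : ℤ) = narayana p a b) (fun b p => ?_)
    (fun b h p => ?_) (fun a b hab h h₁ h₂ p => ?_) b a hab p
  · simp [boundedCount_zero, narayana_zero_left, eq_comm]
  · rw [boundedCount_succ_self, h, narayana_succ_self]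
  · have hrec := congrArg (Nat.cast : ℕ → ℤ) (boundedCount_succ_succ (·.length = p) hab)
    cases p with
    | zero =>
      have hcorner : boundedCount (fun L => ((a + 1, b + 1) :: L).length = 0) a b = 0 := by
        simp [boundedCount]
      rw [hcorner, add_zero, Nat.cast_add, Nat.cast_add, h, h₁, h₂] at hrec
      exact add_right_cancel hrec
    | succ q =>
      simp only [List.length_cons, Nat.add_right_cancel_iff, Nat.cast_add] at hrec
      rw [h, h₁, h₂, h, ← narayana_succ_succ] at hrec
      exact add_right_cancel hrec

theorem not_endsWith_nil (j : ℕ) : ¬EndsWith j [] := by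
  simp [EndsWith, LastBlock]

theorem endsWith_cons {x : ℕ × ℕ} {L : List (ℕ × ℕ)} :
    EndsWith j (x :: L) ↔ EndsWith j L ∨ L = [] ∧ x.2 = j := by
  obtain ⟨i, k⟩ := x
  cases L <;> simp [EndsWith, LastBlock]

theorem boundedCount_endsWith_cons (x : ℕ × ℕ) (j : ℕ) (hab : a ≤ b + 1) :
    boundedCount (fun L => EndsWith j (x :: L)) a b =
      boundedCount (EndsWith j) a b + if x.2 = j then 1 else 0 := by
  simp only [boundedCount, endsWith_cons]
  split_ifs with hx
  · rw [← Set.ncard_insert_of_notMem (a := ([] : List (ℕ × ℕ)))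
      (fun h => not_endsWith_nil j h.2) ((finite_standardBelow hab).inter_of_left _)]
    congr 1
    ext L
    have : L = [] → L ∈ standardBelow a b := fun h => h ▸ nil_mem_standardBelow a b
    simp only [hx, Set.mem_inter_iff, Set.mem_insert_iff, Set.mem_ofPred_eq, and_true]
    tauto
  · simp [hx]

theorem boundedCount_endsWith (haj : a ≤ j + 1) (hab : a ≤ b + 1) :
    boundedCount (EndsWith j) a b + (if a = j + 1 then 1 else 0) =
      if j ≤ b then (a + (b - j)).choose (b - j + 1) else 0 := by
  refine staircase_induction (C := fun a b => a ≤ j + 1 →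
    boundedCount (EndsWith j) a b + (if a = j + 1 then 1 else 0) =
      if j ≤ b then (a + (b - j)).choose (b - j + 1) else 0)
    (fun b _ => ?_) (fun b h hbj => ?_) (fun a b hab _ h₁ h₂ haj => ?_) b a hab haj
  · classical simp [boundedCount_zero, not_endsWith_nil]
  · have := h (by omega)
    rw [boundedCount_succ_self]
    rcases (Nat.le_of_succ_le_succ hbj).eq_or_lt with rfl | hbj
    · simpa using this
    · simpa [hbj.not_ge, hbj.ne, (hbj.trans (Nat.lt_succ_self _)).ne] using this
  · have hrec := boundedCount_succ_succ (EndsWith j) hab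
    rw [boundedCount_endsWith_cons _ _ (by omega)] at hrec
    have h₁ := h₁ (by omega)
    have h₂ := h₂ haj
    rcases lt_trichotomy (b + 1) j with hbj | rfl | hbj
    · grind
    · grind [Nat.choose_one_right]
    · obtain ⟨d, rfl⟩ : ∃ d, b = j + d := ⟨b - j, by omega⟩
      have := Nat.choose_succ_succ' (a + 1 + d) (d + 1)
      grind

end Counting

section ClosedForms

variable {n a b i j p : ℕ} {L : List (ℕ × ℕ)}

theorem firstBlock_cons {k l : ℕ} : FirstBlock k l ((i, j) :: L) ↔ i = k ∧ j = l := by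
  simp [FirstBlock]

theorem startsWith_cons {k : ℕ} : StartsWith k ((i, j) :: L) ↔ i = k := by
  simp [StartsWith, FirstBlock]

theorem not_startsWith_nil (i : ℕ) : ¬StartsWith i [] := by
  simp [StartsWith, FirstBlock]

theorem setOf_isStandard_and_firstBlock (hab : a ≤ b) (hbn : b < n) :
    {L | IsStandard n L ∧ FirstBlock (a + 1) (b + 1) L} =
      List.cons (a + 1, b + 1) '' standardBelow a b := by
  ext L
  constructor
  · rintro ⟨hL, hfirst⟩
    obtain ⟨L, rfl⟩ := List.head?_eq_some_iff.1 hfirst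
    exact ⟨L, (cons_mem_standardBelow.1 (mem_standardBelow_self.2 hL)).2.2.2.2, rfl⟩
  · rintro ⟨L, hL, rfl⟩
    refine ⟨mem_standardBelow_self.1 ?_, firstBlock_cons.2 ⟨rfl, rfl⟩⟩
    exact cons_mem_standardBelow.2 ⟨by omega, by omega, by omega, hbn, hL⟩

theorem cons_mem_standardBelow_iff :
    (i, j) :: L ∈ standardBelow a b ↔ IsStandard b ((i, j) :: L) ∧ i ≤ a := by
  refine and_congr_right fun hL => ?_
  have hlt := (isStandard_cons.1 hL).2.1
  refine List.forall_mem_cons.trans (and_iff_left_of_imp fun hi x hx => ?_)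
  exact (hlt x hx).1.le.trans hi

theorem ncard_startsWith_add_boundedCount (P : List (ℕ × ℕ) → Prop) (han : a ≤ n) :
    {L | IsStandard n L ∧ StartsWith (a + 1) L ∧ P L}.ncard + boundedCount P a n =
      boundedCount P (a + 1) n := by
  have hunion : standardBelow (a + 1) n ∩ {L | P L} =
      {L | IsStandard n L ∧ StartsWith (a + 1) L ∧ P L} ∪ standardBelow a n ∩ {L | P L} := by
    ext L
    rcases L with _ | ⟨⟨i, j⟩, L⟩
    · simp [nil_mem_standardBelow, not_startsWith_nil]
    · simp only [Set.mem_inter_iff, Set.mem_union, Set.mem_ofPred_eq, cons_mem_standardBelow_iff,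
        startsWith_cons, Nat.le_succ_iff]
      tauto
  have hfin : (standardBelow (a + 1) n ∩ {L | P L}).Finite :=
    (finite_standardBelow (by omega)).inter_of_left _
  rw [hunion, Set.finite_union] at hfin
  simp only [boundedCount]
  rw [hunion, Set.ncard_union_eq _ hfin.1 hfin.2]
  refine Set.disjoint_left.2 ?_
  rintro (_ | ⟨⟨i, j⟩, L⟩) ⟨-, hstart, -⟩ ⟨hL, -⟩
  · exact not_startsWith_nil _ hstart
  · have := (cons_mem_standardBelow_iff.1 hL).2
    have := startsWith_cons.1 hstart
    omega

theorem ballot_eq_div_mul_choose (a b : ℕ) :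
    (ballot a b : ℚ) = ((b : ℚ) - a + 1) / (b + 1) * (a + b).choose b := by
  have hchoose : ((a + b).choose (b + 1) : ℚ) * (b + 1) = (a + b).choose b * a := by
    have := Nat.choose_succ_right_eq (a + b) b
    rw [Nat.add_sub_cancel] at this
    exact_mod_cast this
  have : (b : ℚ) + 1 ≠ 0 := by positivity
  rw [ballot]
  push_cast
  field_simp
  linear_combination -hchoose

theorem ncard_firstBlock (hi : 1 ≤ i) (hij : i ≤ j) (hj : j ≤ n) :
    ({L | IsStandard n L ∧ FirstBlock i j L}.ncard : ℚ) =
      ((j : ℚ) - i + 2) / (j + 1) * (j + i - 1).choose j := by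
  obtain ⟨a, rfl⟩ : ∃ a, i = a + 1 := ⟨i - 1, by omega⟩
  obtain ⟨b, rfl⟩ : ∃ b, j = b + 1 := ⟨j - 1, by omega⟩
  have hcount : ({L | IsStandard n L ∧ FirstBlock (a + 1) (b + 1) L}.ncard : ℤ) =
      ballot a (b + 1) := by
    rw [setOf_isStandard_and_firstBlock (by omega) hj,
      Set.ncard_image_of_injective _ List.cons_injective, ← boundedCount_true (by omega)]
    simp [boundedCount]
  rw [← Int.cast_natCast, hcount, ballot_eq_div_mul_choose,
    show b + 1 + (a + 1) - 1 = a + (b + 1) by omega]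
  push_cast
  ring

theorem narayana_succ_sub_narayana (q a b : ℕ) :
    narayana (q + 1) (a + 1) b - narayana (q + 1) a b =
      a.choose q * b.choose (q + 1) - a.choose (q + 1) * b.choose q := by
  simp only [narayana, Nat.choose_succ_succ' a, Nat.cast_add]
  ring

theorem choose_succ_eq_choose_mul_div (m k : ℕ) :
    (m.choose (k + 1) : ℚ) = m.choose k * (m - k) / (k + 1) := by
  rw [eq_div_iff (by positivity)]
  rcases lt_or_ge m k with hmk | hkm
  · simp [Nat.choose_eq_zero_of_lt hmk, Nat.choose_eq_zero_of_lt (hmk.trans (Nat.lt_succ_self k))]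
  · rw [← Nat.cast_sub hkm]
    exact_mod_cast Nat.choose_succ_right_eq m k

theorem ncard_length_startsWith (hi : 1 ≤ i) (hin : i ≤ n) (hp : 1 ≤ p) (hpn : p ≤ n) :
    ({L | IsStandard n L ∧ L.length = p ∧ StartsWith i L}.ncard : ℚ) =
      ((n : ℚ) + 1 - i) / ((n : ℚ) + 1 - p) * (i - 1).choose (p - 1) * n.choose p := by
  obtain ⟨a, rfl⟩ : ∃ a, i = a + 1 := ⟨i - 1, by omega⟩
  obtain ⟨q, rfl⟩ : ∃ q, p = q + 1 := ⟨p - 1, by omega⟩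
  have hcount : ({L | IsStandard n L ∧ L.length = q + 1 ∧ StartsWith (a + 1) L}.ncard : ℤ) =
      a.choose q * n.choose (q + 1) - a.choose (q + 1) * n.choose q := by
    simp only [and_comm (b := StartsWith _ _)]
    rw [← narayana_succ_sub_narayana, ← boundedCount_length _ (by omega),
      ← boundedCount_length _ (by omega), ← ncard_startsWith_add_boundedCount _ (by omega)]
    push_cast
    ring
  have hpos : (n : ℚ) - q ≠ 0 := sub_ne_zero.2 (by exact_mod_cast (by omega : n ≠ q))
  rw [← Int.cast_natCast, hcount, Nat.add_sub_cancel, Nat.add_sub_cancel]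
  push_cast
  rw [choose_succ_eq_choose_mul_div, choose_succ_eq_choose_mul_div, add_sub_add_right_eq_sub,
    add_sub_add_right_eq_sub]
  field_simp
  ring

theorem ncard_startsWith_endsWith_add (hi : 1 ≤ i) (hij : i ≤ j + 1) (hjn : j ≤ n) :
    {L | IsStandard n L ∧ StartsWith i L ∧ EndsWith j L}.ncard + (if i = j + 1 then 1 else 0) =
      (n - j + i - 1).choose (i - 1) := by
  obtain ⟨a, rfl⟩ : ∃ a, i = a + 1 := ⟨i - 1, by omega⟩
  have hcount := ncard_startsWith_add_boundedCount (EndsWith j) (by omega : a ≤ n)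
  have hpred := boundedCount_endsWith (by omega : a ≤ j + 1) (by omega : a ≤ n + 1)
  have hsucc := boundedCount_endsWith hij (by omega : a + 1 ≤ n + 1)
  have hpascal := Nat.choose_succ_succ' (a + (n - j)) (n - j)
  rw [if_pos hjn, if_neg (by omega), add_zero] at hpred
  rw [if_pos hjn, add_right_comm] at hsucc
  rw [Nat.add_sub_cancel, ← add_assoc, Nat.add_sub_cancel, add_comm (n - j), Nat.choose_symm_add]
  omega

theorem ncard_startsWith_endsWith (hi : 1 ≤ i) (hij : i ≤ j) (hjn : j ≤ n) :
    {L | IsStandard n L ∧ StartsWith i L ∧ EndsWith j L}.ncard =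
      (n - j + i - 1).choose (i - 1) := by
  rw [← ncard_startsWith_endsWith_add hi (by omega) hjn, if_neg (by omega),
    add_zero]

theorem ncard_startsWith_endsWith_pred (hi : 1 ≤ i) (hin : i ≤ n + 1) :
    ({L | IsStandard n L ∧ StartsWith i L ∧ EndsWith (i - 1) L}.ncard : ℤ) =
      n.choose (i - 1) - 1 := by
  have h := ncard_startsWith_endsWith_add (n := n) hi (j := i - 1) (by omega) (by omega)
  rw [if_pos (by omega), show n - (i - 1) + i - 1 = n by omega] at h
  omega

end ClosedForms

section Symmetry

variable {n i j p : ℕ} {L : List (ℕ × ℕ)} {P Q : List (ℕ × ℕ) → Prop}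

/-- The action on lists of blocks of inversion followed by the diagram automorphism
`σ_k ↦ σ_{n + 1 - k}`, which exchanges first and last blocks. -/
def flipBlocks (n : ℕ) (L : List (ℕ × ℕ)) : List (ℕ × ℕ) :=
  (L.map fun x => (n + 1 - x.2, n + 1 - x.1)).reverse

theorem isStandard_flipBlocks (hL : IsStandard n L) : IsStandard n (flipBlocks n L) := by
  constructor
  · intro x hx
    simp only [flipBlocks, List.mem_reverse, List.mem_map] at hx
    obtain ⟨y, hy, rfl⟩ := hx
    have := hL.1 y hy
    dsimp only
    omega
  · rw [flipBlocks, List.pairwise_reverse, List.pairwise_map]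
    refine hL.2.imp_of_mem fun {x y} hx hy h => ?_
    have := hL.1 x hx
    have := hL.1 y hy
    dsimp only
    omega

theorem flipBlocks_flipBlocks (hL : IsStandard n L) : flipBlocks n (flipBlocks n L) = L := by
  simp only [flipBlocks, List.map_reverse, List.reverse_reverse, List.map_map]
  refine (List.map_congr_left fun x hx => ?_).trans (List.map_id L)
  have := hL.1 x hx
  simp only [Function.comp_apply, id_eq, Prod.ext_iff]
  omega

theorem ncard_eq_of_flipBlocks (h : ∀ L, IsStandard n L → (P (flipBlocks n L) ↔ Q L)) :
    {L | IsStandard n L ∧ P L}.ncard = {L | IsStandard n L ∧ Q L}.ncard := by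
  refine Set.ncard_congr (fun L _ => flipBlocks n L) ?_ ?_ ?_
  · rintro L ⟨hL, hP⟩
    refine ⟨isStandard_flipBlocks hL, ?_⟩
    rwa [← h _ (isStandard_flipBlocks hL), flipBlocks_flipBlocks hL]
  · rintro L L' ⟨hL, -⟩ ⟨hL', -⟩ heq
    rw [← flipBlocks_flipBlocks hL, heq, flipBlocks_flipBlocks hL']
  · rintro L ⟨hL, hQ⟩
    exact ⟨flipBlocks n L, ⟨isStandard_flipBlocks hL, (h L hL).2 hQ⟩, flipBlocks_flipBlocks hL⟩

theorem lastBlock_flipBlocks (hi : i ≤ n) (hj : j ≤ n) (hL : IsStandard n L) :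
    LastBlock i j (flipBlocks n L) ↔ FirstBlock (n + 1 - j) (n + 1 - i) L := by
  rcases L with _ | ⟨⟨k, l⟩, L⟩
  · simp [LastBlock, FirstBlock, flipBlocks]
  · have := (isStandard_cons.1 hL).1
    simp only [LastBlock, flipBlocks, List.getLast?_reverse, List.map_cons, List.head?_cons,
      Option.some.injEq, Prod.mk.injEq, firstBlock_cons]
    omega

theorem endsWith_flipBlocks (hj : j ≤ n) (hL : IsStandard n L) :
    EndsWith j (flipBlocks n L) ↔ StartsWith (n + 1 - j) L := by
  rcases L with _ | ⟨⟨k, l⟩, L⟩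
  · simp [EndsWith, LastBlock, StartsWith, FirstBlock, flipBlocks]
  · have := (isStandard_cons.1 hL).1
    simp only [EndsWith, LastBlock, flipBlocks, List.getLast?_reverse, List.map_cons,
      List.head?_cons, Option.some.injEq, Prod.mk.injEq, exists_and_right, exists_eq', true_and,
      startsWith_cons]
    omega

theorem length_flipBlocks (n : ℕ) (L : List (ℕ × ℕ)) : (flipBlocks n L).length = L.length := by
  rw [flipBlocks, List.length_reverse, List.length_map]

theorem ncard_lastBlock (hi : 1 ≤ i) (hij : i ≤ j) (hj : j ≤ n) :
    ({L | IsStandard n L ∧ LastBlock i j L}.ncard : ℚ) =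
      ((j : ℚ) - i + 2) / ((n : ℚ) - i + 2) * (2 * n + 1 - j - i).choose (n - j) := by
  rw [ncard_eq_of_flipBlocks fun L hL => lastBlock_flipBlocks (hij.trans hj) hj hL,
    ncard_firstBlock (by omega) (by omega) (by omega),
    Nat.choose_symm_of_eq_add (b := n - j) (by omega),
    show n + 1 - i + (n + 1 - j) - 1 = 2 * n + 1 - j - i by omega,
    Nat.cast_sub (by omega), Nat.cast_sub (by omega)]
  push_cast
  congr 2 <;> ring

theorem ncard_length_endsWith (hj : 1 ≤ j) (hjn : j ≤ n) (hp : 1 ≤ p) (hpn : p ≤ n) :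
    ({L | IsStandard n L ∧ L.length = p ∧ EndsWith j L}.ncard : ℚ) =
      (j : ℚ) / ((n : ℚ) + 1 - p) * (n - j).choose (p - 1) * n.choose p := by
  rw [ncard_eq_of_flipBlocks (Q := fun L => L.length = p ∧ StartsWith (n + 1 - j) L)
      fun L hL => by rw [length_flipBlocks, endsWith_flipBlocks hjn hL],
    ncard_length_startsWith (by omega) (by omega) hp hpn, Nat.cast_sub (by omega),
    show n + 1 - j - 1 = n - j by omega]
  push_cast
  congr 3
  ring

end Symmetry

end FCTypeA

open FCTypeA in
theorem mainTheorem8 {W : Type*} [Group W] {n : ℕ}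
    (cs : CoxeterSystem (CoxeterMatrix.A n) W) :
    (∀ i j : ℕ, 1 ≤ i → i ≤ j → j ≤ n →
      ((fcWith cs (FirstBlock i j)).ncard : ℚ) =
          ((j : ℚ) - i + 2) / (j + 1) * (Nat.choose (j + i - 1) j : ℚ) ∧
      ((fcWith cs (LastBlock i j)).ncard : ℚ) =
          ((j : ℚ) - i + 2) / ((n : ℚ) - i + 2) * (Nat.choose (2 * n + 1 - j - i) (n - j) : ℚ)) ∧
    (∀ i p : ℕ, 1 ≤ i → i ≤ n → 1 ≤ p → p ≤ n →
      ((fcWith cs (fun L => L.length = p ∧ StartsWith i L)).ncard : ℚ) =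
          ((n : ℚ) + 1 - i) / ((n : ℚ) + 1 - p) *
            (Nat.choose (i - 1) (p - 1) : ℚ) * (Nat.choose n p : ℚ)) ∧
    (∀ j p : ℕ, 1 ≤ j → j ≤ n → 1 ≤ p → p ≤ n →
      ((fcWith cs (fun L => L.length = p ∧ EndsWith j L)).ncard : ℚ) =
          (j : ℚ) / ((n : ℚ) + 1 - p) *
            (Nat.choose (n - j) (p - 1) : ℚ) * (Nat.choose n p : ℚ)) ∧
    (∀ i j : ℕ, 1 ≤ i → i ≤ j → j ≤ n →
      (fcWith cs (fun L => StartsWith i L ∧ EndsWith j L)).ncard =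
        Nat.choose (n - j + i - 1) (i - 1)) ∧
    (∀ i : ℕ, 2 ≤ i → i ≤ n →
      ((fcWith cs (fun L => StartsWith i L ∧ EndsWith (i - 1) L)).ncard : ℤ) =
        (Nat.choose n (i - 1) : ℤ) - 1) := by
  simp only [ncard_fcWith]
  exact ⟨fun _ _ hi hij hj => ⟨ncard_firstBlock hi hij hj, ncard_lastBlock hi hij hj⟩,
    fun _ _ => ncard_length_startsWith,
    fun _ _ => ncard_length_endsWith,
    fun _ _ => ncard_startsWith_endsWith,
    fun _ hi hin => ncard_startsWith_endsWith_pred (by omega) (by omega)⟩
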